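/- Let $K$ be a field and let $\Delta$ be a quasi-tree on a finite vertex set. Then the following conditions are equivalent: (i) the vertex cover algebra $A(\Gamma)$ over $K$ is standard graded for every subcomplex $\Gamma$ of maximal dimension of $\Delta$; (ii) the vertex cover algebra $A(\Delta)$ over $K$ is standard graded; (iii) $\Delta$ has no special odd cycle. Here the following terms are used. The facets of a simplicial complex are its maximal faces. A subcomplex $\Gamma\subseteq\Delta$ is of maximal dimension if every facet of $\Gamma$ is a facet of $\Delta$. A facet $F$ of a complex is a leaf if it is the only facet or if there is a facet $G\neq F$ such that $H\cap F\subseteq G\cap F$ for all facets $H\neq F$. A quasi-tree is a connected (non-empty) simplicial complex whose facets can be ordered $F_1,\dots,F_m$ such that, for every $i$, $F_i$ is a leaf of the complex with the facets $F_1,\dots,F_i$. Let $V(\Gamma)$ be the vertex set of $\Gamma$ and $S=K[x_v : v\in V(\Gamma)]$. A vector $a\in\mathbb{N}^{V(\Gamma)}$ is a $k$-cover of $\Gamma$ if $\sum_{v\in F}a_v\ge k$ for every facet $F$ of $\Gamma$. The vertex cover algebra $A(\Gamma)=\bigoplus_{k\ge 0}A_k(\Gamma)\subseteq S[t]$ is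 the graded $S$-algebra for which $A_k(\Gamma)$ is the $K$-span of the monomials $x^a t^k$ with $a$ a $k$-cover of $\Gamma$. It is standard graded if the maximal degree of a generator in a minimal set of homogeneous generators of $A(\Gamma)$ as an $S$-algebra is $1$. A cycle of $\Delta$ of length $s\ge 2$ is a sequence $v_1,F_1,v_2,F_2,\dots,v_s,F_s,v_{s+1}=v_1$ with distinct vertices $v_1,\dots,v_s$ and distinct facets $F_1,\dots,F_s$ of $\Delta$ such that $v_i,v_{i+1}\in F_i$ for all $i=1,\dots,s$. It is odd if $s$ is odd, and special if none of the facets $F_1,\dots,F_s$ of the cycle contains more than two of the vertices $v_1,\dots,v_s$. -/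

import Mathlib

open scoped Polynomial

noncomputable section

namespace QuasiTree

universe u v

/-! ### Simplicial complexes

A simplicial complex is Mathlib's `PreAbstractSimplicialComplex V` over a finite ambient type `V`
(Mathlib does not list the empty face). Its vertex set is `vertices Δ`, which may be smaller than
`V`; in this way a subcomplex has its own vertex set. -/

section Complexes

variable {V : Type u}

/-- The vertex set of `Δ`: all `x` such that `{x}` is a face. -/
def vertices (Δ : PreAbstractSimplicialComplex V) : Set V :=
  {x | ({x} : Finset V) ∈ Δ.faces}

/-- The facets of `Δ`: its faces that are maximal under inclusion. -/
def facets (Δ : PreAbstractSimplicialComplex V) : Set (Finset V) :=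
  {F | Maximal (fun G => G ∈ Δ.faces) F}

/-- `Γ` is a subcomplex of maximal dimension of `Δ`: a subcomplex all of whose facets are facets
of `Δ`. -/
def IsSMD (Γ Δ : PreAbstractSimplicialComplex V) : Prop :=
  Γ ≤ Δ ∧ facets Γ ⊆ facets Δ

/-- `G` is a branch of the facet `F` of `Δ`: another facet that contains the intersection of `F`
with every facet other than `F`. -/
def IsBranch (Δ : PreAbstractSimplicialComplex V) (F G : Finset V) : Prop :=
  G ∈ facets Δ ∧ G ≠ F ∧
    ∀ H ∈ facets Δ, H ≠ F → (H : Set V) ∩ (F : Set V) ⊆ (G : Set V) ∩ (F : Set V)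

/-- The facet `F` is a leaf of `Δ`: it is the only facet or it has a branch. -/
def IsLeaf (Δ : PreAbstractSimplicialComplex V) (F : Finset V) : Prop :=
  F ∈ facets Δ ∧ (facets Δ = {F} ∨ ∃ G, IsBranch Δ F G)

/-- `F 0, …, F (m - 1)` is a leaf order of `Δ`: an enumeration without repetition of the facets
of `Δ` such that each `F i` is a leaf of the subcomplex of maximal dimension with the facets
`F 0, …, F i`. -/
def IsLeafOrder (Δ : PreAbstractSimplicialComplex V) {m : ℕ} (F : Fin m → Finset V) : Prop :=
  Function.Injective F ∧ Set.range F = facets Δ ∧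
    ∀ i, ∃ Γ, IsSMD Γ Δ ∧ facets Γ = F '' Set.Iic i ∧ IsLeaf Γ (F i)

/-- A quasi-forest is a simplicial complex that has a leaf order. -/
def IsQuasiForest (Δ : PreAbstractSimplicialComplex V) : Prop :=
  ∃ (m : ℕ) (F : Fin m → Finset V), IsLeafOrder Δ F

/-- The 1-skeleton of `Δ` as a graph on the vertex set of `Δ`: distinct vertices are adjacent
if some face contains both. -/
def skeletonGraph (Δ : PreAbstractSimplicialComplex V) : SimpleGraph (vertices Δ) where
  Adj x y := x ≠ y ∧ ∃ F ∈ Δ.faces, (x : V) ∈ F ∧ (y : V) ∈ F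
  symm := ⟨fun _ _ h => ⟨h.1.symm, h.2.imp fun _ hF => ⟨hF.1, hF.2.2, hF.2.1⟩⟩⟩
  loopless := ⟨fun _ h => h.1 rfl⟩

/-- A quasi-tree is a connected quasi-forest. -/
def IsQuasiTree (Δ : PreAbstractSimplicialComplex V) : Prop :=
  (skeletonGraph Δ).Connected ∧ IsQuasiForest Δ

/-- `x 0, F 0, x 1, F 1, …, x (s - 1), F (s - 1), x 0` is a cycle of `Δ`, where `finRotate s` is
the cyclic shift `i ↦ i + 1`. -/
structure IsCycle (Δ : PreAbstractSimplicialComplex V) {s : ℕ}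
    (x : Fin s → V) (F : Fin s → Finset V) : Prop where
  two_le : 2 ≤ s
  vertex_injective : Function.Injective x
  facet_injective : Function.Injective F
  facet_mem : ∀ i, F i ∈ facets Δ
  mem : ∀ i, x i ∈ F i
  next_mem : ∀ i, x (finRotate s i) ∈ F i

/-- The cycle is special: no facet of the cycle contains more than two vertices of the cycle. -/
def IsSpecial {s : ℕ} (x : Fin s → V) (F : Fin s → Finset V) : Prop :=
  ∀ i, ((F i : Set V) ∩ Set.range x).ncard ≤ 2

/-- `Δ` has a special cycle of odd length. -/
def HasSpecialOddCycle (Δ : PreAbstractSimplicialComplex V) : Prop :=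
  ∃ (s : ℕ) (x : Fin s → V) (F : Fin s → Finset V), Odd s ∧ IsCycle Δ x F ∧ IsSpecial x F

end Complexes

/-! ### Standard graded algebras -/

section Graded

variable {R : Type u} {A : Type v} [CommRing R] [CommRing A] [Algebra R A]

/-- `G` is a minimal set of homogeneous generators of the `R`-algebra `A` with the graded
components `𝒜 k`. -/
def IsMinimalGeneratingSet (𝒜 : ℕ → Submodule R A) (G : Set A) : Prop :=
  Minimal (fun G : Set A => (∀ g ∈ G, ∃ k, g ∈ 𝒜 k) ∧ Algebra.adjoin R G = ⊤) G

/-- `d` is the maximal degree of a generator in a minimal generating set of the graded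
algebra `A`. -/
def HasMaxGeneratorDegree (𝒜 : ℕ → Submodule R A) (d : ℕ) : Prop :=
  ∃ G, IsMinimalGeneratingSet 𝒜 G ∧ IsGreatest {k | ∃ g ∈ G, g ∈ 𝒜 k} d

/-- The graded algebra `A` is standard graded over `R`, its component of degree zero: the maximal
degree of a generator in a minimal generating set is one. -/
def IsStandardGraded (𝒜 : ℕ → Submodule R A) : Prop :=
  HasMaxGeneratorDegree 𝒜 1

end Graded

/-! ### Vertex cover algebras -/

section CoverAlgebra

variable {V : Type u}

open Classical in
/-- `a` is a cover of order `k` of `Γ`: its sum over each facet is at least `k`. -/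
def IsCover (Γ : PreAbstractSimplicialComplex V) (k : ℕ) (a : vertices Γ →₀ ℕ) : Prop :=
  ∀ F ∈ facets Γ, k ≤ ∑ x ∈ F.subtype (fun x => x ∈ vertices Γ), a x

theorem isCover_zero (Γ : PreAbstractSimplicialComplex V) (a : vertices Γ →₀ ℕ) :
    IsCover Γ 0 a := fun _ _ => Nat.zero_le _

theorem IsCover.add {Γ : PreAbstractSimplicialComplex V} {k l : ℕ} {a b : vertices Γ →₀ ℕ}
    (ha : IsCover Γ k a) (hb : IsCover Γ l b) : IsCover Γ (k + l) (a + b) := by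
  intro F hF
  simp only [Finsupp.add_apply, Finset.sum_add_distrib]
  exact add_le_add (ha F hF) (hb F hF)

variable (K : Type v) [Field K]

/-- The monomials `x ^ a * t ^ k` of `S[t]`, where `S = K[x_v : v ∈ vertices Γ]` and `a` runs
through the covers of order `k` of `Γ`. -/
def coverMonomials (Γ : PreAbstractSimplicialComplex V) (k : ℕ) :
    Set (MvPolynomial (vertices Γ) K)[X] :=
  {p | ∃ a, IsCover Γ k a ∧ p = Polynomial.monomial k (MvPolynomial.monomial a 1)}

theorem smul_mem_span {Γ : PreAbstractSimplicialComplex V}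
    {M : Set (MvPolynomial (vertices Γ) K)[X]}
    (hM : ∀ (b : vertices Γ →₀ ℕ), ∀ p ∈ M, MvPolynomial.monomial b (1 : K) • p ∈ M)
    (r : MvPolynomial (vertices Γ) K) {p : (MvPolynomial (vertices Γ) K)[X]}
    (hp : p ∈ Submodule.span K M) : r • p ∈ Submodule.span K M := by
  induction hp using Submodule.span_induction with
  | mem p hp =>
    induction r using MvPolynomial.induction_on' with
    | monomial b c =>
      have : MvPolynomial.monomial b c = c • MvPolynomial.monomial b (1 : K) := by
        simp [MvPolynomial.smul_monomial]
      rw [this, smul_assoc]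
      exact Submodule.smul_mem _ _ (Submodule.subset_span (hM b p hp))
    | add r s hr hs => rw [add_smul]; exact add_mem hr hs
  | zero => simp
  | add p q _ _ hp hq => rw [smul_add]; exact add_mem hp hq
  | smul c p _ hp => rw [smul_comm]; exact Submodule.smul_mem _ _ hp

theorem smul_mem_coverMonomials {Γ : PreAbstractSimplicialComplex V} {k : ℕ}
    (b : vertices Γ →₀ ℕ) {p : (MvPolynomial (vertices Γ) K)[X]}
    (hp : p ∈ coverMonomials K Γ k) :
    MvPolynomial.monomial b (1 : K) • p ∈ coverMonomials K Γ k := by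
  obtain ⟨a, ha, rfl⟩ := hp
  refine ⟨b + a, ?_, by simp [Polynomial.smul_monomial, MvPolynomial.monomial_mul]⟩
  simpa using (isCover_zero Γ b).add ha

/-- The vertex cover algebra `A(Γ)`, as an `S`-subalgebra of `S[t]`: its elements are the
`K`-linear combinations of the monomials `x ^ a * t ^ k` with `a` a cover of order `k` of `Γ`. -/
def vertexCoverAlgebra (Γ : PreAbstractSimplicialComplex V) :
    Subalgebra (MvPolynomial (vertices Γ) K) (MvPolynomial (vertices Γ) K)[X] where
  carrier := Submodule.span K (⋃ k, coverMonomials K Γ k)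
  add_mem' := fun hp hq => add_mem hp hq
  mul_mem' := by
    intro p q hp hq
    have h := Submodule.mul_mem_mul hp hq
    rw [Submodule.span_mul_span] at h
    refine Submodule.span_mono ?_ h
    rintro _ ⟨p, hp, q, hq, rfl⟩
    obtain ⟨k, a, ha, rfl⟩ := Set.mem_iUnion.1 hp
    obtain ⟨l, b, hb, rfl⟩ := Set.mem_iUnion.1 hq
    exact Set.mem_iUnion.2 ⟨k + l, a + b, ha.add hb, by
      simp [Polynomial.monomial_mul_monomial, MvPolynomial.monomial_mul]⟩
  algebraMap_mem' := by
    intro r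
    rw [Algebra.algebraMap_eq_smul_one]
    refine smul_mem_span K (fun b p hp => ?_) r (Submodule.subset_span ?_)
    · obtain ⟨k, hk⟩ := Set.mem_iUnion.1 hp
      exact Set.mem_iUnion.2 ⟨k, smul_mem_coverMonomials K b hk⟩
    · exact Set.mem_iUnion.2 ⟨0, 0, isCover_zero Γ 0, by simp⟩

/-- The graded component `A_k(Γ)` of the vertex cover algebra: the `K`-linear span of the
monomials `x ^ a * t ^ k` with `a` a cover of order `k` of `Γ`. -/
def coverComponent (Γ : PreAbstractSimplicialComplex V) (k : ℕ) :
    Submodule (MvPolynomial (vertices Γ) K) (vertexCoverAlgebra K Γ) where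
  carrier := {p | (p : (MvPolynomial (vertices Γ) K)[X]) ∈
    Submodule.span K (coverMonomials K Γ k)}
  add_mem' := fun hp hq => (Submodule.span K (coverMonomials K Γ k)).add_mem hp hq
  zero_mem' := (Submodule.span K (coverMonomials K Γ k)).zero_mem
  smul_mem' := fun r _ hp => smul_mem_span K (fun b _ hq => smul_mem_coverMonomials K b hq) r hp

/-- The vertex cover algebra `A(Γ)` over `K` is standard graded. -/
def VertexCoverAlgebraIsStandardGraded (Γ : PreAbstractSimplicialComplex V) : Prop :=
  IsStandardGraded (R := MvPolynomial (vertices Γ) K) (A := vertexCoverAlgebra K Γ)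
    (coverComponent K Γ)

end CoverAlgebra

end QuasiTree

end

noncomputable section

namespace QuasiTree

/-! ### Balanced hypergraphs -/

section Balanced

/-! Monomials turn the algebra into combinatorics: `A(Γ)` is standard graded exactly when every
`k`-cover dominates a sum of `k` covers of order one (`isDecomposable_of_isStandardGraded`,
`isStandardGraded_of_isDecomposable`).

Having no special odd cycle says that the facets form a balanced hypergraph, a property inherited by
subcomplexes of maximal dimension. Balanced hypergraphs can be bicolored on every vertex subset.
Hence a weight splits into two nearly equal halves, both positive on every edge of weight at least
two, and repeated resplitting decomposes every `k`-cover (`IsBalanced.exists_decomposition`). This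
part needs no leaf order.

Conversely, let a special odd cycle be given. Put weight 1 on its vertices, 0 on the other vertices
of its facets, and 2 elsewhere. By parity this weight does not dominate a sum of two covers. That it
is a 2-cover uses the leaf order: a facet off the cycle but inside the union of the cycle's facets
contains two cycle vertices (`IsSeparating.exists_two_mem`), because a facet of a quasi-forest
separates the others as in `IsSeparating`. -/

theorem finRotate_of_lt' {s : ℕ} {i : Fin s} (h : (i : ℕ) + 1 < s) :
    finRotate s i = ⟨i + 1, h⟩ := by
  have : NeZero s := ⟨by lia⟩
  rw [finRotate_apply]
  exact Fin.ext (Fin.val_add_one_of_lt' h)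

theorem finRotate_of_eq {s : ℕ} {i : Fin s} (h : (i : ℕ) + 1 = s) (hs : 0 < s) :
    finRotate s i = ⟨0, hs⟩ := by
  obtain ⟨k, rfl⟩ : ∃ k, s = k + 1 := ⟨i, h.symm⟩
  obtain rfl : i = Fin.last k := Fin.ext (by simpa using h)
  exact finRotate_last

/-- A shortest odd closed walk has no repeated vertex: a repetition would cut it into two shorter
closed walks, one of them odd. -/
theorem exists_odd_cycle_of_not_colorable {α : Type*} {G : SimpleGraph α} (h : ¬ G.Colorable 2) :
    ∃ (s : ℕ) (x : Fin s → α), Odd s ∧ 2 ≤ s ∧ Function.Injective x ∧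
      ∀ i, G.Adj (x i) (x (finRotate s i)) := by
  classical
  rw [SimpleGraph.two_colorable_iff_forall_loop_even] at h
  push Not at h
  have hex : ∃ n, Odd n ∧ ∃ (u : α) (w : G.Walk u u), w.length = n := by
    obtain ⟨u, w, hw⟩ := h
    exact ⟨_, by simpa using hw, u, w, rfl⟩
  obtain ⟨hodd, u, w, hw⟩ := Nat.find_spec hex
  have hmin := fun m => Nat.find_min (H := hex) (m := m)
  rw [← hw] at hodd
  replace hmin : ∀ v, ∀ p : G.Walk v v, p.length < w.length → ¬ Odd p.length := by
    intro v p hp ho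
    exact hmin p.length (hw ▸ hp) ⟨ho, v, p, rfl⟩
  have hadj := fun i => w.adj_getVert_succ (i := i)
  have hs : 2 ≤ w.length := by
    by_contra hs
    have h1 : w.length = 1 := by
      obtain ⟨k, hk⟩ := hodd
      lia
    have := hadj 0 (by lia)
    rw [w.getVert_of_length_le (by lia : w.length ≤ 0 + 1), w.getVert_zero] at this
    exact this.ne rfl
  have key : ∀ i j, i < j → j < w.length → w.getVert i ≠ w.getVert j := by
    intro i j hij hj he
    let p : G.Walk u u := ((w.take i).copy rfl he).append (w.drop j)
    let q : G.Walk (w.getVert i) (w.getVert i) :=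
      ((w.drop i).take (j - i)).copy rfl (by
        rw [SimpleGraph.Walk.drop_getVert, he]; congr 1; lia)
    have hp : p.length = i + (w.length - j) := by
      simp [p, SimpleGraph.Walk.take_length, SimpleGraph.Walk.drop_length]; lia
    have hq : q.length = j - i := by
      simp [q, SimpleGraph.Walk.take_length, SimpleGraph.Walk.drop_length]; lia
    have h1 := hmin _ p (by lia)
    have h2 := hmin _ q (by lia)
    rw [Nat.not_odd_iff_even] at h1 h2
    have := h1.add h2
    rw [hp, hq] at this
    have e : i + (w.length - j) + (j - i) = w.length := by lia
    rw [e] at this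
    exact Nat.not_even_iff_odd.2 hodd this
  refine ⟨w.length, fun i => w.getVert i, hodd, hs, ?_, ?_⟩
  · intro i j hij
    by_contra hne
    rcases lt_or_gt_of_ne (fun h => hne (Fin.ext h)) with h | h
    · exact key _ _ h j.2 hij
    · exact key _ _ h i.2 hij.symm
  · intro i
    have h := hadj i i.2
    by_cases hi : (i : ℕ) + 1 < w.length
    · rw [finRotate_of_lt' hi]
      exact h
    · have hi' : (i : ℕ) + 1 = w.length := by lia
      rw [hi', w.getVert_length] at h
      rw [finRotate_of_eq hi' (by lia)]
      simpa using h

/-- Take for `v` a non-cut vertex of its component. Two neighbours of `v` are joined by a walk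
avoiding `v`, along which `c xor d` is constant; since `c` agrees on the neighbours, so does `d`.
This lets a bicoloring be extended to `v`. -/
theorem exists_removable_vertex {α : Type*} [Finite α] [Nonempty α] (G : SimpleGraph α) :
    ∃ v, ∀ c d : α → Bool, (∀ x y, G.Adj x y → c x ≠ c y) →
      (∀ x y, G.Adj x y → x ≠ v → y ≠ v → d x ≠ d y) →
      ∀ y z, G.Adj v y → G.Adj v z → d y = d z := by
  obtain ⟨v₀⟩ := ‹Nonempty α›
  let C := G.connectedComponentMk v₀
  obtain ⟨v, hv⟩ :=
    C.connected_toSimpleGraph.exists_preconnected_induce_compl_singleton_of_finite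
  refine ⟨v, fun c d hc hd y z hy hz => ?_⟩
  have hC : ∀ y, G.Adj v y → y ∈ C.supp := fun y hy =>
    C.mem_supp_of_adj_mem_supp v.2 hy
  have hne : ∀ y (h : G.Adj v y), (⟨y, hC y h⟩ : C.supp) ∈ ({v}ᶜ : Set C.supp) := by
    intro y h h'
    have : y = v := congrArg Subtype.val h'
    exact h.ne this.symm
  obtain ⟨p⟩ := hv ⟨_, hne y hy⟩ ⟨_, hne z hz⟩
  have key : ∀ a b (p : ((SimpleGraph.induce {v}ᶜ C.toSimpleGraph)).Walk a b),
      xor (c a.1) (d a.1) = xor (c b.1) (d b.1) := by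
    intro a b p
    induction p with
    | nil => rfl
    | @cons a b e h p ih =>
      rw [← ih]
      have hadj : G.Adj a.1 b.1 := h
      have h1 := hc _ _ hadj
      have h2 := hd _ _ hadj (fun h => a.2 (Subtype.ext h)) (fun h => b.2 (Subtype.ext h))
      revert h1 h2
      cases c a.1 <;> cases c b.1 <;> cases d a.1 <;> cases d b.1 <;> simp
  have h1 := key _ _ p
  have h2 := hc _ _ hy
  have h3 := hc _ _ hz
  revert h1 h2 h3
  simp only
  cases c v <;> cases c y <;> cases c z <;> cases d y <;> cases d z <;> simp

variable {ι α : Type*}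

/-- The hypergraph with the edges `E i` is balanced: every cycle of odd length has an edge that
contains more than two vertices of the cycle. -/
def IsBalanced (E : ι → Finset α) : Prop :=
  ∀ (s : ℕ) (x : Fin s → α) (e : Fin s → ι), Odd s → 2 ≤ s → Function.Injective x →
    Function.Injective e → (∀ i, x i ∈ E (e i)) → (∀ i, x (finRotate s i) ∈ E (e i)) →
    ∃ i, 2 < ((E (e i) : Set α) ∩ Set.range x).ncard

variable [DecidableEq α]

/-- The graph on `W` whose edges are the two-element traces on `W` of the edges `E i`. -/
def traceGraph (E : ι → Finset α) (W : Finset α) : SimpleGraph W where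
  Adj x y := x ≠ y ∧ ∃ i, E i ∩ W = {(x : α), (y : α)}
  symm := ⟨fun _ _ h => ⟨h.1.symm, h.2.imp fun _ hi => by rw [hi, Finset.pair_comm]⟩⟩
  loopless := ⟨fun _ h => h.1 rfl⟩

/-- An odd cycle of the trace graph lifts to an odd cycle of the hypergraph each of whose edges
meets it in only two vertices, against balance. -/
theorem IsBalanced.traceGraph_colorable {E : ι → Finset α} (hE : IsBalanced E) (W : Finset α) :
    (traceGraph E W).Colorable 2 := by
  by_contra h
  obtain ⟨s, x, hodd, hs, hx, hadj⟩ := exists_odd_cycle_of_not_colorable h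
  choose e he using fun i => (hadj i).2
  have hmem : ∀ i (y : W), (y : α) ∈ E (e i) ↔ y = x i ∨ y = x (finRotate s i) := by
    intro i y
    have : (y : α) ∈ E (e i) ∩ W ↔ (y : α) ∈ ({↑(x i), ↑(x (finRotate s i))} : Finset α) := by
      rw [he i]
    simp only [Finset.mem_inter, y.2, and_true, Finset.mem_insert, Finset.mem_singleton,
      Subtype.val_inj] at this
    exact this
  have he_inj : Function.Injective e := by
    intro i j hij
    by_contra hne
    have h1 := (hmem j (x i)).1 (hij ▸ (hmem i _).2 (Or.inl rfl))
    have h2 := (hmem j (x (finRotate s i))).1 (hij ▸ (hmem i _).2 (Or.inr rfl))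
    rw [hx.eq_iff, hx.eq_iff] at h1 h2
    replace h1 := h1.resolve_left hne
    replace h2 := h2.resolve_right fun h => hne ((finRotate s).injective h)
    -- Now `i` is the successor of `j` and `j` that of `i`, which forces `s = 2`, contrary to
    -- parity.
    have hval : ∀ i : Fin s, (finRotate s i : ℕ) = i + 1 ∨
        (finRotate s i : ℕ) = 0 ∧ i + 1 = s := by
      intro i
      by_cases h : (i : ℕ) + 1 < s
      · exact Or.inl (by rw [finRotate_of_lt' h])
      · have h' : (i : ℕ) + 1 = s := by lia
        exact Or.inr ⟨by rw [finRotate_of_eq h' (by lia)], h'⟩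
    have h3 := hval i
    have h4 := hval j
    rw [h2] at h3
    rw [← h1] at h4
    obtain ⟨k, hk⟩ := hodd
    lia
  obtain ⟨i, hi⟩ := hE s (fun i => x i) e hodd hs (Subtype.val_injective.comp hx) he_inj
    (fun i => (hmem i _).2 (Or.inl rfl)) (fun i => (hmem i _).2 (Or.inr rfl))
  have hsub : (E (e i) : Set α) ∩ Set.range (fun i => (x i : α)) ⊆
      ({↑(x i), ↑(x (finRotate s i))} : Finset α) := by
    rintro _ ⟨hy, j, rfl⟩
    rw [← he i]
    exact Finset.mem_inter.2 ⟨hy, (x j).2⟩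
  have := (Set.ncard_le_ncard hsub (Finset.finite_toSet _)).trans
    ((Set.ncard_coe_finset _).trans_le Finset.card_le_two)
  lia

/-- A balanced hypergraph is bicolorable. -/
theorem IsBalanced.exists_bicoloring {E : ι → Finset α} (hE : IsBalanced E) (W : Finset α) :
    ∃ c : α → Bool, ∀ i, 2 ≤ (E i ∩ W).card → ∀ b, ∃ x ∈ E i ∩ W, c x = b := by
  induction W using Finset.strongInduction with
  | H W ih =>
  rcases W.eq_empty_or_nonempty with rfl | hW
  · exact ⟨fun _ => true, by simp⟩
  have : Nonempty W := hW.to_subtype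
  obtain ⟨v, hv⟩ := exists_removable_vertex (traceGraph E W)
  obtain ⟨c⟩ := hE.traceGraph_colorable W
  obtain ⟨d, hd⟩ := ih (W.erase v) (Finset.erase_ssubset v.2)
  -- A two-element trace that avoids `v` is unchanged in `W.erase v`, so `d` already separates its
  -- ends.
  have hdadj : ∀ x y, (traceGraph E W).Adj x y → x ≠ v → y ≠ v → d x ≠ d y := by
    rintro x y ⟨hxy, i, hi⟩ hx hy h
    have hi' : E i ∩ W.erase v = {(x : α), (y : α)} := by
      rw [Finset.inter_erase, hi, Finset.erase_eq_of_notMem]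
      simp [hx.symm, hy.symm]
    have hcard : 2 ≤ (E i ∩ W.erase v).card := by
      rw [hi', Finset.card_pair (Subtype.coe_injective.ne hxy)]
    obtain ⟨z, hz, hz'⟩ := hd i hcard (!d x)
    rw [hi'] at hz
    simp only [Finset.mem_insert, Finset.mem_singleton] at hz
    rcases hz with rfl | rfl
    · simp at hz'
    · simp [← h] at hz'
  have hnb := hv (fun x => finTwoEquiv (c x)) (fun x => d x)
    (fun x y h => finTwoEquiv.injective.ne (c.valid h)) hdadj
  obtain ⟨b₀, hb₀⟩ : ∃ b₀ : Bool, ∀ y, (traceGraph E W).Adj v y → d y ≠ b₀ := by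
    by_cases h : ∃ y, (traceGraph E W).Adj v y
    · obtain ⟨y, hy⟩ := h
      exact ⟨!d y, fun z hz => by rw [hnb z y hz hy]; simp⟩
    · exact ⟨true, fun y hy => (h ⟨y, hy⟩).elim⟩
  refine ⟨Function.update d v b₀, fun i hi b => ?_⟩
  by_cases hcard : 2 ≤ (E i ∩ W.erase v).card
  · obtain ⟨x, hx, hxb⟩ := hd i hcard b
    rw [Finset.inter_erase, Finset.mem_erase] at hx
    exact ⟨x, hx.2, by rw [Function.update_of_ne hx.1, hxb]⟩
  -- The remaining traces are pairs `{v, y}` with `y` a neighbour of `v`, and `b₀` differs from the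
  -- color of `y`.
  · rw [Finset.inter_erase] at hcard
    have hvi : (v : α) ∈ E i ∩ W := by
      by_contra h
      rw [Finset.erase_eq_of_notMem h] at hcard
      exact hcard hi
    rw [Finset.card_erase_of_mem hvi] at hcard
    have h2 : ((E i ∩ W).erase v).card = 1 := by
      rw [Finset.card_erase_of_mem hvi]; lia
    obtain ⟨y, hy⟩ := Finset.card_eq_one.1 h2
    have hyi : y ∈ (E i ∩ W).erase v := by rw [hy]; simp
    obtain ⟨hyv, hyi⟩ := Finset.mem_erase.1 hyi
    have hadj : (traceGraph E W).Adj v ⟨y, (Finset.mem_inter.1 hyi).2⟩ := by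
      refine ⟨fun h => hyv (congrArg Subtype.val h).symm, i, ?_⟩
      exact (Finset.insert_erase hvi).symm.trans (congrArg (insert (v : α)) hy)
    have hne := hb₀ _ hadj
    by_cases hb : b = b₀
    · exact ⟨v, hvi, by simp [hb]⟩
    · refine ⟨y, hyi, ?_⟩
      rw [Function.update_of_ne hyv]
      revert hne hb
      simp only
      cases b <;> cases b₀ <;> cases d y <;> simp

/-- A weight on a balanced hypergraph is a sum of two weights, both positive on every edge of
weight at least two. -/
theorem IsBalanced.exists_split {E : ι → Finset α} (hE : IsBalanced E) (g : α →₀ ℕ) :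
    ∃ g₁ g₂ : α →₀ ℕ, g₁ + g₂ = g ∧
      ∀ i, 2 ≤ ∑ x ∈ E i, g x → 1 ≤ ∑ x ∈ E i, g₁ x ∧ 1 ≤ ∑ x ∈ E i, g₂ x := by
  obtain ⟨c, hc⟩ := hE.exists_bicoloring {x ∈ g.support | g x = 1}
  -- Values other than 1 are halved, with rounding; the indivisible ones go to the side given by the
  -- bicoloring of the vertices of weight 1.
  let f : Bool → α → ℕ := fun b x => if g x = 1 then (if c x = b then 1 else 0) else
    if b then g x / 2 else g x - g x / 2
  let g' : Bool → α →₀ ℕ := fun b => Finsupp.onFinset g.support (f b) (by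
    intro x hx
    by_contra h
    simp only [Finsupp.mem_support_iff, not_not] at h
    simp [f, h] at hx)
  have hpos : ∀ i, 2 ≤ ∑ x ∈ E i, g x → ∀ b, 1 ≤ ∑ x ∈ E i, g' b x := by
    intro i hi b
    suffices h : ∃ x ∈ E i, 1 ≤ g' b x by
      obtain ⟨x, hx, h1⟩ := h
      exact h1.trans (Finset.single_le_sum (f := fun x => g' b x) (fun _ _ => Nat.zero_le _) hx)
    by_cases hbig : ∃ x ∈ E i, 2 ≤ g x
    · obtain ⟨x, hx, h2⟩ := hbig
      refine ⟨x, hx, ?_⟩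
      simp only [g', Finsupp.onFinset_apply, f]
      rw [if_neg (by lia)]
      split_ifs <;> lia
    · push Not at hbig
      have hcard : 2 ≤ (E i ∩ {x ∈ g.support | g x = 1}).card := by
        refine hi.trans ?_
        rw [Finset.card_eq_sum_ones, ← Finset.sum_subset (Finset.inter_subset_left
          (s₁ := E i) (s₂ := {x ∈ g.support | g x = 1}))]
        · refine Finset.sum_le_sum fun x hx => ?_
          have := hbig x (Finset.mem_inter.1 hx).1
          lia
        · intro x hx hx'
          by_contra h0
          have := hbig x hx
          exact hx' (by simp [hx]; lia)
      obtain ⟨x, hx, hxb⟩ := hc i hcard b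
      simp only [Finset.mem_inter, Finset.mem_filter] at hx
      exact ⟨x, hx.1, by simp [g', f, hx.2.2, hxb]⟩
  refine ⟨g' true, g' false, ?_, fun i hi => ⟨hpos i hi _, hpos i hi _⟩⟩
  ext x
  simp only [g', Finsupp.add_apply, Finsupp.onFinset_apply, f]
  by_cases h : g x = 1
  · cases hcx : c x <;> simp [h]
  · simp [h]; lia

/-- Every cover of order `k` of a balanced hypergraph dominates a sum of `k` covers of order
one. -/
theorem IsBalanced.exists_decomposition [Finite ι] {E : ι → Finset α} (hE : IsBalanced E) {k : ℕ}
    {a : α →₀ ℕ} (ha : ∀ i, k ≤ ∑ x ∈ E i, a x) :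
    ∃ m : Multiset (α →₀ ℕ), m.card = k ∧ m.sum ≤ a ∧ ∀ b ∈ m, ∀ i, 1 ≤ ∑ x ∈ E i, b x := by
  rcases Nat.eq_zero_or_pos k with rfl | hk
  · exact ⟨0, by simp⟩
  have := Fintype.ofFinite ι
  let n : (α →₀ ℕ) → ℕ := fun b => ∑ i, if ∑ x ∈ E i, b x = 0 then 1 else 0
  let P : Multiset (α →₀ ℕ) → Prop := fun m => m.card = k ∧ m.sum = a
  have hne : {m | P m}.Nonempty := by
    refine ⟨a ::ₘ Multiset.replicate (k - 1) 0, ?_, ?_⟩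
    · simp; lia
    · simp
  -- Among the ways to write `a` as a sum of `k` weights, minimize the number of pairs of a summand
  -- and an edge on which it vanishes.
  obtain ⟨m, ⟨hm, hsum⟩, hmin⟩ := WellFounded.has_min
    (measure fun m : Multiset (α →₀ ℕ) => (m.map n).sum).wf _ hne
  refine ⟨m, hm, hsum.le, fun q hq i => ?_⟩
  by_contra hqi
  obtain ⟨t, rfl⟩ := Multiset.exists_cons_of_mem hq
  have hsumE : ∀ t : Multiset (α →₀ ℕ),
      (t.map fun b => ∑ x ∈ E i, b x).sum = ∑ x ∈ E i, t.sum x := by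
    intro t
    induction t using Multiset.induction_on with
    | empty => simp
    | cons b t ih => simp [ih, Finset.sum_add_distrib]
  -- Pigeonhole: edge `i` has total weight at least `k`, and `q` contributes nothing.
  obtain ⟨p, hp, hpi⟩ : ∃ p ∈ t, 2 ≤ ∑ x ∈ E i, p x := by
    by_contra hcon
    push Not at hcon
    have h1 : (t.map fun b => ∑ x ∈ E i, b x).sum ≤ (t.map fun b => ∑ x ∈ E i, b x).card • 1 := by
      refine Multiset.sum_le_card_nsmul _ _ fun y hy => ?_
      obtain ⟨b, hb, rfl⟩ := Multiset.mem_map.1 hy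
      exact Nat.lt_succ_iff.1 (hcon b hb)
    have h2 := ha i
    rw [← hsum, ← hsumE] at h2
    simp only [Multiset.map_cons, Multiset.sum_cons] at h2
    simp only [Multiset.card_map, smul_eq_mul, mul_one] at h1
    simp only [Multiset.card_cons] at hm
    lia
  obtain ⟨t, rfl⟩ := Multiset.exists_cons_of_mem hp
  obtain ⟨g₁, g₂, hg, hpos⟩ := hE.exists_split (q + p)
  refine hmin (g₁ ::ₘ g₂ ::ₘ t) ⟨by simpa using hm, ?_⟩ ?_
  · rw [← hsum]
    simp [← add_assoc, hg]
  -- Resplitting `q + p` leaves no zero on edges of joint weight at least two, and the same number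
  -- on lighter edges; on edge `i` a zero is gained back.
  · have hlt : n g₁ + n g₂ < n q + n p := by
      simp only [n, ← Finset.sum_add_distrib]
      have hs : ∀ j, ∑ x ∈ E j, g₁ x + ∑ x ∈ E j, g₂ x = ∑ x ∈ E j, q x + ∑ x ∈ E j, p x := by
        intro j
        simp only [← Finset.sum_add_distrib]
        exact Finset.sum_congr rfl fun x _ => DFunLike.congr_fun hg x
      have hpos' : ∀ j, 2 ≤ ∑ x ∈ E j, q x + ∑ x ∈ E j, p x →
          1 ≤ ∑ x ∈ E j, g₁ x ∧ 1 ≤ ∑ x ∈ E j, g₂ x := by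
        intro j hj
        refine hpos j ?_
        simpa [Finset.sum_add_distrib] using hj
      refine Finset.sum_lt_sum (fun j _ => ?_) ⟨i, Finset.mem_univ i, ?_⟩
      · have h1 := hs j
        have h2 := hpos' j
        split_ifs <;> lia
      · have h1 := hs i
        have h2 := hpos' i
        split_ifs <;> lia
    show ((g₁ ::ₘ g₂ ::ₘ t).map n).sum < ((q ::ₘ p ::ₘ t).map n).sum
    simp only [Multiset.map_cons, Multiset.sum_cons]
    lia

end Balanced

/-! ### Standard graded vertex cover algebras -/

section Decomposition

universe u v

variable {V : Type u} {Γ : PreAbstractSimplicialComplex V}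

/-- `a` dominates a sum of `k` covers of order one of `Γ`. -/
def IsDecomposable (Γ : PreAbstractSimplicialComplex V) (k : ℕ) (a : vertices Γ →₀ ℕ) : Prop :=
  ∃ m : Multiset (vertices Γ →₀ ℕ), m.card = k ∧ m.sum ≤ a ∧ ∀ b ∈ m, IsCover Γ 1 b

theorem isDecomposable_zero (a : vertices Γ →₀ ℕ) : IsDecomposable Γ 0 a :=
  ⟨0, by simp⟩

theorem IsCover.isDecomposable {a : vertices Γ →₀ ℕ} (ha : IsCover Γ 1 a) :
    IsDecomposable Γ 1 a :=
  ⟨{a}, by simpa using ha⟩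

theorem IsDecomposable.add {k l : ℕ} {a b : vertices Γ →₀ ℕ} (ha : IsDecomposable Γ k a)
    (hb : IsDecomposable Γ l b) : IsDecomposable Γ (k + l) (a + b) := by
  obtain ⟨m, rfl, hma, hm⟩ := ha
  obtain ⟨n, rfl, hnb, hn⟩ := hb
  refine ⟨m + n, by simp, by simpa using add_le_add hma hnb, fun c hc => ?_⟩
  exact (Multiset.mem_add.1 hc).elim (hm c) (hn c)

theorem mem_vertices_of_mem {F : Finset V} (hF : F ∈ Γ.faces) {x : V} (hx : x ∈ F) :
    x ∈ vertices Γ :=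
  (Γ.isRelLowerSet_faces hF).2 (Finset.singleton_subset_iff.2 hx) (Finset.singleton_nonempty x)

theorem exists_vertex_mem {F : Finset V} (hF : F ∈ facets Γ) : ∃ x : vertices Γ, (x : V) ∈ F := by
  obtain ⟨x, hx⟩ := (Γ.isRelLowerSet_faces hF.prop).1
  exact ⟨⟨x, mem_vertices_of_mem hF.prop hx⟩, hx⟩

theorem isCover_one_iff {a : vertices Γ →₀ ℕ} :
    IsCover Γ 1 a ↔ ∀ F ∈ facets Γ, ∃ x : vertices Γ, (x : V) ∈ F ∧ 1 ≤ a x := by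
  classical
  refine forall₂_congr fun F _ => ?_
  rw [Nat.one_le_iff_ne_zero, ne_eq, Finset.sum_eq_zero_iff]
  push Not
  exact exists_congr fun x => by rw [Finset.mem_subtype, Nat.one_le_iff_ne_zero]

theorem coeff_ne_zero_of_mem_span {K : Type v} [Field K] {k : ℕ}
    {p : (MvPolynomial (vertices Γ) K)[X]}
    (hp : p ∈ Submodule.span K (coverMonomials K Γ k)) {l : ℕ} {a : vertices Γ →₀ ℕ}
    (h : (p.coeff l).coeff a ≠ 0) : l = k ∧ IsCover Γ k a := by
  classical
  induction hp using Submodule.span_induction with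
  | mem p hp =>
    obtain ⟨b, hb, rfl⟩ := hp
    rw [Polynomial.coeff_monomial] at h
    split_ifs at h with hk
    · rw [MvPolynomial.coeff_monomial] at h
      split_ifs at h with hab
      · exact ⟨hk.symm, hab ▸ hb⟩
      · exact (h rfl).elim
    · simp at h
  | zero => simp at h
  | add p q _ _ hp hq =>
    by_cases h0 : (p.coeff l).coeff a = 0
    · exact hq (by simpa [h0] using h)
    · exact hp h0
  | smul c p _ hp =>
    refine hp fun h0 => h ?_
    rw [Polynomial.coeff_smul, MvPolynomial.coeff_smul, h0, smul_zero]

variable (K : Type v) [Field K]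

variable (Γ) in
/-- The subalgebra of `S[t]` of the polynomials whose monomials `x ^ a * t ^ k` have `a`
decomposable of order `k`. -/
def decomposableSubalgebra :
    Subalgebra (MvPolynomial (vertices Γ) K) (MvPolynomial (vertices Γ) K)[X] where
  carrier := {p | ∀ k a, (p.coeff k).coeff a ≠ 0 → IsDecomposable Γ k a}
  add_mem' := by
    intro p q hp hq k a h
    by_cases h0 : (p.coeff k).coeff a = 0
    · exact hq k a (by simpa [h0] using h)
    · exact hp k a h0
  mul_mem' := by
    classical
    intro p q hp hq k a h
    rw [Polynomial.coeff_mul, MvPolynomial.coeff_sum] at h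
    obtain ⟨⟨i, j⟩, hij, h⟩ := Finset.exists_ne_zero_of_sum_ne_zero h
    rw [MvPolynomial.coeff_mul] at h
    obtain ⟨⟨b, c⟩, hbc, h⟩ := Finset.exists_ne_zero_of_sum_ne_zero h
    rw [Finset.HasAntidiagonal.mem_antidiagonal] at hij hbc
    have := (hp i b (left_ne_zero_of_mul h)).add (hq j c (right_ne_zero_of_mul h))
    rwa [← hij, ← hbc]
  algebraMap_mem' := by
    intro r k a h
    rw [Polynomial.algebraMap_apply, Polynomial.coeff_C] at h
    split_ifs at h with hk
    · exact hk ▸ isDecomposable_zero a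
    · simp at h

/-- Generators of degree at most one lie in `decomposableSubalgebra`, hence so does the whole
algebra. -/
theorem isDecomposable_of_isStandardGraded (h : VertexCoverAlgebraIsStandardGraded K Γ) {k : ℕ}
    {a : vertices Γ →₀ ℕ} (ha : IsCover Γ k a) : IsDecomposable Γ k a := by
  classical
  obtain ⟨G, hG, hdeg⟩ := h
  have hmem : Polynomial.monomial k (MvPolynomial.monomial a (1 : K)) ∈ vertexCoverAlgebra K Γ :=
    Submodule.subset_span (Set.mem_iUnion.2 ⟨k, a, ha, rfl⟩)
  have hle : Algebra.adjoin (MvPolynomial (vertices Γ) K) G ≤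
      (decomposableSubalgebra Γ K).comap (vertexCoverAlgebra K Γ).val := by
    refine Algebra.adjoin_le fun g hg => ?_
    obtain ⟨l, hl⟩ := hG.prop.1 g hg
    have hl1 : l ≤ 1 := hdeg.2 ⟨g, hg, hl⟩
    intro j b hb
    obtain ⟨rfl, hb⟩ := coeff_ne_zero_of_mem_span hl hb
    interval_cases j
    · exact isDecomposable_zero b
    · exact hb.isDecomposable
  rw [hG.prop.2] at hle
  exact hle (Algebra.mem_top (x := (⟨_, hmem⟩ : vertexCoverAlgebra K Γ))) k a (by simp)

theorem isStandardGraded_of_isDecomposable [Finite V]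
    (h : ∀ k a, IsCover Γ k a → IsDecomposable Γ k a) :
    VertexCoverAlgebraIsStandardGraded K Γ := by
  classical
  let one : vertices Γ →₀ ℕ := Finsupp.equivFunOnFinite.symm 1
  have hone : IsCover Γ 1 one := isCover_one_iff.2 fun F hF =>
    (exists_vertex_mem hF).imp fun x hx => ⟨hx, le_rfl⟩
  let mon : {a // IsCover Γ 1 a} → vertexCoverAlgebra K Γ := fun a =>
    ⟨Polynomial.monomial 1 (MvPolynomial.monomial a.1 (1 : K)),
      Submodule.subset_span (Set.mem_iUnion.2 ⟨1, a, a.2, rfl⟩)⟩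
  have hmon : ∀ a, mon a ∈ coverComponent K Γ 1 := fun a =>
    Submodule.subset_span ⟨a, a.2, rfl⟩
  have hmon_mem : ∀ a k, mon a ∈ coverComponent K Γ k → k = 1 := fun a k hk =>
    (coeff_ne_zero_of_mem_span hk (l := 1) (a := a.1) (by simp [mon])).1.symm
  -- The squarefree covers suffice: truncating a 1-cover at `one` leaves a 1-cover, and the excess
  -- is a coefficient from `S`. Their finiteness yields a minimal generating subset.
  let G₀ : Set (vertexCoverAlgebra K Γ) := mon '' {a | a.1 ≤ one}
  have hfin : G₀.Finite :=
    ((Set.finite_Iic one).preimage Subtype.val_injective.injOn).image _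
  have hadjoin : Algebra.adjoin (MvPolynomial (vertices Γ) K) G₀ = ⊤ := by
    let B := (Algebra.adjoin (MvPolynomial (vertices Γ) K) G₀).map (vertexCoverAlgebra K Γ).val
    have hmono : ∀ (k : ℕ) (a b : vertices Γ →₀ ℕ), a ≤ b →
        Polynomial.monomial k (MvPolynomial.monomial a (1 : K)) ∈ B →
        Polynomial.monomial k (MvPolynomial.monomial b (1 : K)) ∈ B := by
      intro k a b hab ha
      have := B.smul_mem ha (MvPolynomial.monomial (b - a) (1 : K))
      rwa [Polynomial.smul_monomial, smul_eq_mul, MvPolynomial.monomial_mul, one_mul,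
        tsub_add_cancel_of_le hab] at this
    have hB : ∀ a, IsCover Γ 1 a →
        Polynomial.monomial 1 (MvPolynomial.monomial a (1 : K)) ∈ B := by
      intro a ha
      have ha' : IsCover Γ 1 (a ⊓ one) := isCover_one_iff.2 fun F hF =>
        (isCover_one_iff.1 ha F hF).imp fun x hx => ⟨hx.1, by simpa [one] using hx.2⟩
      refine hmono 1 (a ⊓ one) a inf_le_left ?_
      exact ⟨mon ⟨_, ha'⟩, Algebra.subset_adjoin ⟨_, inf_le_right (a := a), rfl⟩, rfl⟩
    have hsum : ∀ m : Multiset (vertices Γ →₀ ℕ), (∀ b ∈ m, IsCover Γ 1 b) →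
        Polynomial.monomial m.card (MvPolynomial.monomial m.sum (1 : K)) ∈ B := by
      intro m
      induction m using Multiset.induction_on with
      | empty => exact fun _ => one_mem B
      | cons b m ih =>
        intro hm
        have := B.mul_mem (hB b (hm b (Multiset.mem_cons_self b m)))
          (ih fun c hc => hm c (Multiset.mem_cons_of_mem hc))
        rwa [Polynomial.monomial_mul_monomial, MvPolynomial.monomial_mul, one_mul, add_comm 1,
          ← Multiset.card_cons b m, ← Multiset.sum_cons] at this
    have hspan : ∀ p ∈ Submodule.span K (⋃ k, coverMonomials K Γ k), p ∈ B := by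
      intro p hp
      induction hp using Submodule.span_induction with
      | mem p hp =>
        obtain ⟨k, a, ha, rfl⟩ := Set.mem_iUnion.1 hp
        obtain ⟨m, rfl, hma, hm⟩ := h k a ha
        exact hmono _ _ _ hma (hsum m hm)
      | zero => exact zero_mem B
      | add p q _ _ hp hq => exact add_mem hp hq
      | smul c p _ hp =>
        rw [← algebraMap_smul (MvPolynomial (vertices Γ) K) c p]
        exact B.smul_mem hp _
    refine eq_top_iff.2 fun p _ => ?_
    obtain ⟨q, hq, hqp⟩ := hspan p.1 p.2
    rwa [← Subtype.ext hqp]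
  obtain ⟨G, hG, hGmin⟩ := (hfin.finite_subsets.subset (t := {G | G ⊆ G₀ ∧
    Algebra.adjoin (MvPolynomial (vertices Γ) K) G = ⊤}) fun G hG => hG.1).exists_minimal
      ⟨G₀, subset_rfl, hadjoin⟩
  refine ⟨G, ⟨⟨fun g hg => ?_, hG.2⟩, fun G' hG' hle => hGmin ⟨hle.trans hG.1, hG'.2⟩ hle⟩,
    ?_, ?_⟩
  · obtain ⟨a, _, rfl⟩ := hG.1 hg
    exact ⟨1, hmon a⟩
  -- Without generators the algebra would be `S`, which misses the degree-one monomial of `one`.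
  · obtain ⟨g, hg⟩ : G.Nonempty := by
      by_contra hne
      rw [Set.not_nonempty_iff_eq_empty] at hne
      have htop := hG.2
      rw [hne, Algebra.adjoin_empty] at htop
      have : mon ⟨one, hone⟩ ∈ (⊥ : Subalgebra (MvPolynomial (vertices Γ) K) _) :=
        htop ▸ Algebra.mem_top
      obtain ⟨r, hr⟩ := Algebra.mem_bot.1 this
      have := congrArg (fun p => p.1.coeff 1) hr
      simp [mon, eq_comm (a := (0 : MvPolynomial (vertices Γ) K))] at this
    obtain ⟨a, _, rfl⟩ := hG.1 hg
    exact ⟨_, hg, hmon a⟩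
  · rintro k ⟨g, hg, hk⟩
    obtain ⟨a, _, rfl⟩ := hG.1 hg
    exact (hmon_mem a k hk).le

end Decomposition

/-! ### Separation by a facet of a quasi-forest -/

section Separation

universe u

variable {V : Type u}

/-- Every member `H` of `𝒢` splits the other members of `𝒢` into classes such that members of
different classes meet inside `H`, and such that the intersections of `H` with the members of one
class all lie in a single member other than `H`. -/
def IsSeparating (𝒢 : Set (Finset V)) : Prop :=
  ∀ H ∈ 𝒢, ∃ c : Finset V → ℕ,
    (∀ F ∈ 𝒢, ∀ G ∈ 𝒢, F ≠ H → G ≠ H → c F ≠ c G → ∀ x ∈ F, x ∈ G → x ∈ H) ∧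
    ∀ F₀ ∈ 𝒢, F₀ ≠ H → ∃ G ∈ 𝒢, G ≠ H ∧
      ∀ F ∈ 𝒢, F ≠ H → c F = c F₀ → ∀ x ∈ H, x ∈ F → x ∈ G

theorem isSeparating_singleton (L : Finset V) : IsSeparating {L} := by
  rintro H rfl
  exact ⟨fun _ => 0, fun F hF _ _ h => (h hF).elim, fun F hF h => (h hF).elim⟩

/-- The new leaf `L` with branch `G` meets all other members inside `G`. Thus one class suffices for
`H = L`; for `H = G` the leaf forms a fresh class; for any other `H` it joins the class of `G`. -/
theorem IsSeparating.insert {𝒢 : Set (Finset V)} (h𝒢 : IsSeparating 𝒢) (hfin : 𝒢.Finite)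
    {L G : Finset V} (hL : L ∉ 𝒢) (hG : G ∈ 𝒢) (hGL : ∀ F ∈ 𝒢, ∀ x ∈ F, x ∈ L → x ∈ G) :
    IsSeparating (insert L 𝒢) := by
  classical
  have hne : ∀ F ∈ 𝒢, F ≠ L := fun F hF h => hL (h ▸ hF)
  rintro H (rfl | hH)
  · refine ⟨fun _ => 0, fun _ _ _ _ _ _ h => (h rfl).elim, fun _ _ _ => ?_⟩
    refine ⟨G, Or.inr hG, hne G hG, ?_⟩
    rintro F (rfl | hF) hF' - x hx hxF
    · exact (hF' rfl).elim
    · exact hGL F hF x hxF hx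
  · obtain ⟨c, hc₁, hc₂⟩ := h𝒢 H hH
    by_cases hGH : G = H
    · subst hGH
      obtain ⟨n, hn⟩ := (hfin.image c).exists_notMem
      have hn' : ∀ F ∈ 𝒢, c F ≠ n := fun F hF h => hn ⟨F, hF, h⟩
      refine ⟨Function.update c L n, ?_, ?_⟩
      · rintro F (rfl | hF) F' (rfl | hF') hFG hFG' hcc x hx hx'
        · exact (hcc rfl).elim
        · exact hGL F' hF' x hx' hx
        · exact hGL F hF x hx hx'
        · rw [Function.update_of_ne (hne F hF), Function.update_of_ne (hne F' hF')] at hcc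
          exact hc₁ F hF F' hF' hFG hFG' hcc x hx hx'
      · rintro F₀ (rfl | hF₀) hF₀G
        · refine ⟨F₀, Or.inl rfl, hF₀G, ?_⟩
          rintro F (rfl | hF) - hcc x hx hxF
          · exact hxF
          · rw [Function.update_of_ne (hne F hF), Function.update_self] at hcc
            exact (hn' F hF hcc).elim
        · obtain ⟨G', hG', hG'H, h⟩ := hc₂ F₀ hF₀ hF₀G
          refine ⟨G', Or.inr hG', hG'H, ?_⟩
          rw [Function.update_of_ne (hne F₀ hF₀)]
          rintro F (rfl | hF) hFG hcc
          · rw [Function.update_self] at hcc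
            exact (hn' F₀ hF₀ hcc.symm).elim
          · rw [Function.update_of_ne (hne F hF)] at hcc
            exact h F hF hFG hcc
    · refine ⟨Function.update c L (c G), ?_, ?_⟩
      · rintro F (rfl | hF) F' (rfl | hF') hFH hFH' hcc x hx hx'
        · exact (hcc rfl).elim
        · rw [Function.update_self, Function.update_of_ne (hne F' hF')] at hcc
          exact hc₁ G hG F' hF' hGH hFH' hcc x (hGL F' hF' x hx' hx) hx'
        · rw [Function.update_self, Function.update_of_ne (hne F hF)] at hcc
          exact hc₁ F hF G hG hFH hGH hcc x hx (hGL F hF x hx hx')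
        · rw [Function.update_of_ne (hne F hF), Function.update_of_ne (hne F' hF')] at hcc
          exact hc₁ F hF F' hF' hFH hFH' hcc x hx hx'
      · have key : ∀ F₀ ∈ 𝒢, F₀ ≠ H → ∃ G' ∈ Insert.insert L 𝒢, G' ≠ H ∧
            ∀ F ∈ Insert.insert L 𝒢, F ≠ H → Function.update c L (c G) F = c F₀ →
              ∀ x ∈ H, x ∈ F → x ∈ G' := by
          intro F₀ hF₀ hF₀H
          obtain ⟨G', hG', hG'H, h⟩ := hc₂ F₀ hF₀ hF₀H
          refine ⟨G', Or.inr hG', hG'H, ?_⟩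
          rintro F (rfl | hF) hFH hcc x hx hxF
          · rw [Function.update_self] at hcc
            exact h G hG hGH hcc x hx (hGL H hH x hx hxF)
          · rw [Function.update_of_ne (hne F hF)] at hcc
            exact h F hF hFH hcc x hx hxF
        rintro F₀ (rfl | hF₀) hF₀H
        · rw [Function.update_self]
          exact key G hG hGH
        · rw [Function.update_of_ne (hne F₀ hF₀)]
          exact key F₀ hF₀ hF₀H

theorem IsLeafOrder.isSeparating {Δ : PreAbstractSimplicialComplex V} {m : ℕ}
    {F : Fin m → Finset V} (hF : IsLeafOrder Δ F) : IsSeparating (facets Δ) := by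
  obtain ⟨hinj, hrange, hleaf⟩ := hF
  have key : ∀ n ≤ m, IsSeparating (F '' {i | (i : ℕ) < n}) := by
    intro n
    induction n with
    | zero => simp [IsSeparating]
    | succ n ih =>
      intro hn
      specialize ih (by lia)
      let l : Fin m := ⟨n, hn⟩
      have hset : F '' {i | (i : ℕ) < n + 1} = insert (F l) (F '' {i | (i : ℕ) < n}) := by
        rw [← Set.image_insert_eq]
        congr 1
        ext i
        simp [l, Fin.ext_iff]
        lia
      have hIic : F '' Set.Iic l = F '' {i | (i : ℕ) < n + 1} := by
        congr 1
        ext i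
        simp [l, Fin.le_def]
      have hl : F l ∉ F '' {i | (i : ℕ) < n} := by
        rintro ⟨i, hi, h⟩
        rw [hinj h] at hi
        exact lt_irrefl n hi
      obtain ⟨Γ, -, hΓ, -, hone | ⟨G, hG, hGl, hbr⟩⟩ := hleaf l
      · rw [← hIic, ← hΓ, hone]
        exact isSeparating_singleton _
      · rw [hΓ, hIic, hset] at hG hbr
        rw [hset]
        exact ih.insert (Set.toFinite _) hl (hG.resolve_left hGl) fun F' hF' x hx hxl =>
          (hbr F' (Or.inr hF') (fun h => hl (h ▸ hF')) ⟨hx, hxl⟩).1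
  have h := key m le_rfl
  have huniv : {i : Fin m | (i : ℕ) < m} = Set.univ := by
    ext i
    simp
  rwa [huniv, Set.image_univ, hrange] at h

end Separation

/-! ### Special odd cycles in quasi-forests -/

section SpecialCycle

universe u

/-- Going around a circle, a value that is left must be entered again: the indicator of that value
has the same sum after rotation, so a drop forces a rise elsewhere. -/
theorem exists_ne_finRotate {s : ℕ} {c : Fin s → ℕ} (hc : ¬ ∃ n, ∀ i, c i = n) :
    ∃ i j, i ≠ j ∧ c i ≠ c (finRotate s i) ∧ c j ≠ c (finRotate s j) := by
  obtain ⟨i, hi⟩ : ∃ i, c i ≠ c (finRotate s i) := by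
    by_contra! hcon
    rcases Nat.eq_zero_or_pos s with rfl | hs
    · exact hc ⟨0, fun i => i.elim0⟩
    refine hc ⟨c ⟨0, hs⟩, ?_⟩
    rintro ⟨i, hi⟩
    induction i with
    | zero => rfl
    | succ i ih =>
      rw [← ih (by lia), hcon ⟨i, by lia⟩, finRotate_of_lt']
  let f : Fin s → ℕ := fun j => if c j = c i then 1 else 0
  have hsum : ∑ j, f (finRotate s j) = ∑ j, f j := Equiv.sum_comp _ f
  obtain ⟨j, hj⟩ : ∃ j, f j < f (finRotate s j) := by
    by_contra! hcon
    have hlt : f (finRotate s i) < f i := by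
      simp only [f, if_neg hi.symm, if_true, zero_lt_one]
    exact (Finset.sum_lt_sum (fun j _ => hcon j) ⟨i, Finset.mem_univ i, hlt⟩).ne hsum
  have hj' : c j ≠ c i ∧ c (finRotate s j) = c i := by
    simp only [f] at hj
    split_ifs at hj <;> simp_all
  refine ⟨i, j, fun h => hj'.1 (by rw [h]), hi, fun h => hj'.1 (h.trans hj'.2)⟩

variable {V : Type u} {Δ : PreAbstractSimplicialComplex V}

/-- If all cycle facets were in one class, `H` would lie in another facet. Otherwise the class
changes at two places of the cycle, and the vertex shared by the two facets at each change lies in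
`H`. -/
theorem IsSeparating.exists_two_mem (hΔ : IsSeparating (facets Δ)) {s : ℕ} {x : Fin s → V}
    {F : Fin s → Finset V} (hcyc : IsCycle Δ x F) {H : Finset V} (hH : H ∈ facets Δ)
    (hHF : ∀ i, F i ≠ H) (hsub : ∀ y ∈ H, ∃ i, y ∈ F i) :
    ∃ i j, i ≠ j ∧ x i ∈ H ∧ x j ∈ H := by
  obtain ⟨c, hc₁, hc₂⟩ := hΔ H hH
  have hs : 0 < s := zero_lt_two.trans_le hcyc.two_le
  obtain ⟨i, j, hij, hi, hj⟩ : ∃ i j, i ≠ j ∧ c (F i) ≠ c (F (finRotate s i)) ∧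
      c (F j) ≠ c (F (finRotate s j)) := by
    refine exists_ne_finRotate (c := fun i => c (F i)) ?_
    rintro ⟨n, hn⟩
    obtain ⟨G, hG, hGH, h⟩ := hc₂ (F ⟨0, hs⟩) (hcyc.facet_mem _) (hHF _)
    have hle : H ≤ G := fun y hy => by
      obtain ⟨i, hi⟩ := hsub y hy
      exact h (F i) (hcyc.facet_mem i) (hHF i) ((hn i).trans (hn _).symm) y hy hi
    exact hGH (le_antisymm (hH.2 hG.prop hle) hle)
  have hmem : ∀ i, c (F i) ≠ c (F (finRotate s i)) → x (finRotate s i) ∈ H := fun i hi =>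
    hc₁ _ (hcyc.facet_mem i) _ (hcyc.facet_mem _) (hHF i) (hHF _) hi _ (hcyc.next_mem i)
      (hcyc.mem _)
  exact ⟨_, _, (finRotate s).injective.ne hij, hmem i hi, hmem j hj⟩

theorem finRotate_ne_self {s : ℕ} (hs : 2 ≤ s) (i : Fin s) : finRotate s i ≠ i := by
  intro h
  have h := congrArg Fin.val h
  by_cases hi : (i : ℕ) + 1 < s
  · rw [finRotate_of_lt' hi] at h
    simp at h
  · rw [finRotate_of_eq (by lia) (by lia)] at h
    simp only at h
    lia

theorem IsCycle.eq_or_eq_of_isSpecial {s : ℕ} {x : Fin s → V} {F : Fin s → Finset V}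
    (hcyc : IsCycle Δ x F) (hspec : IsSpecial x F) {i j : Fin s} (h : x j ∈ F i) :
    j = i ∨ j = finRotate s i := by
  classical
  by_contra! hne
  have hsub : (({x i, x (finRotate s i), x j} : Finset V) : Set V) ⊆
      (F i : Set V) ∩ Set.range x := by
    intro y hy
    simp only [Finset.coe_insert, Finset.coe_singleton, Set.mem_insert_iff,
      Set.mem_singleton_iff] at hy
    rcases hy with rfl | rfl | rfl
    · exact ⟨hcyc.mem i, i, rfl⟩
    · exact ⟨hcyc.next_mem i, _, rfl⟩
    · exact ⟨h, j, rfl⟩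
  have hcard := Set.ncard_le_ncard hsub ((Finset.finite_toSet _).inter_of_left _)
  rw [Set.ncard_coe_finset, Finset.card_eq_three.2 ⟨_, _, _,
    hcyc.vertex_injective.ne (finRotate_ne_self hcyc.two_le i).symm,
    hcyc.vertex_injective.ne hne.1.symm, hcyc.vertex_injective.ne hne.2.symm, rfl⟩] at hcard
  have := hspec i
  lia

/-- A quasi-forest with a special odd cycle has an indecomposable cover of order two. -/
theorem IsSeparating.not_isDecomposable [Finite V] (hΔ : IsSeparating (facets Δ))
    (hcyc : HasSpecialOddCycle Δ) : ∃ a, IsCover Δ 2 a ∧ ¬ IsDecomposable Δ 2 a := by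
  classical
  obtain ⟨s, x, F, hodd, hcyc, hspec⟩ := hcyc
  let X : Fin s → vertices Δ := fun i => ⟨x i, mem_vertices_of_mem (hcyc.facet_mem i).prop
    (hcyc.mem i)⟩
  let a : vertices Δ →₀ ℕ := Finsupp.equivFunOnFinite.symm fun y =>
    if y ∈ Set.range X then 1 else if ∃ i, (y : V) ∈ F i then 0 else 2
  have haX : ∀ i, a (X i) = 1 := fun i => if_pos ⟨i, rfl⟩
  refine ⟨a, ?_, ?_⟩
  · intro H hH
    have htwo : ∀ i j, i ≠ j → x i ∈ H → x j ∈ H →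
        2 ≤ ∑ y ∈ H.subtype (fun y => y ∈ vertices Δ), a y := by
      intro i j hij hi hj
      have hne : X i ≠ X j := fun h => hij (hcyc.vertex_injective (congrArg Subtype.val h))
      calc 2 = ∑ y ∈ {X i, X j}, a y := by rw [Finset.sum_pair hne, haX, haX]
        _ ≤ _ := by
          refine Finset.sum_le_sum_of_subset fun y hy => ?_
          rw [Finset.mem_subtype]
          rcases Finset.mem_insert.1 hy with rfl | hy
          · exact hi
          · rw [Finset.mem_singleton.1 hy]
            exact hj
    by_cases hHF : ∃ i, F i = H
    · obtain ⟨i, rfl⟩ := hHF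
      convert htwo _ _ (finRotate_ne_self hcyc.two_le i) (hcyc.next_mem i) (hcyc.mem i)
    push Not at hHF
    by_cases hsub : ∀ y ∈ H, ∃ i, y ∈ F i
    · obtain ⟨i, j, hij, hi, hj⟩ := hΔ.exists_two_mem hcyc hH hHF hsub
      convert htwo i j hij hi hj
    · push Not at hsub
      obtain ⟨y, hy, hyF⟩ := hsub
      let Y : vertices Δ := ⟨y, mem_vertices_of_mem hH.prop hy⟩
      have hY : a Y = 2 := by
        refine (if_neg ?_).trans (if_neg ?_)
        · rintro ⟨i, hi⟩
          have hxy : x i = y := congrArg Subtype.val hi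
          exact hyF i (hxy ▸ hcyc.mem i)
        · rintro ⟨i, hi⟩
          exact hyF i hi
      rw [← hY]
      exact Finset.single_le_sum (f := fun y => a y) (fun _ _ => Nat.zero_le _)
        (Finset.mem_subtype.2 hy)
  · rintro ⟨m, hm, hma, hcov⟩
    obtain ⟨p, q, rfl⟩ := Multiset.card_eq_two.1 hm
    rw [Multiset.sum_pair] at hma
    have hle : ∀ y, p y + q y ≤ a y := fun y => hma y
    -- On a cycle facet `a` is supported on the two cycle vertices there, as the cycle is special.
    have hone : ∀ b, IsCover Δ 1 b → b ≤ a → ∀ i, 1 ≤ b (X i) + b (X (finRotate s i)) := by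
      intro b hb hba i
      obtain ⟨y, hy, hby⟩ := isCover_one_iff.1 hb (F i) (hcyc.facet_mem i)
      have hay : 1 ≤ a y := hby.trans (hba y)
      obtain ⟨j, rfl⟩ : y ∈ Set.range X := by
        by_contra hyX
        have : a y = 0 := (if_neg hyX).trans (if_pos ⟨i, hy⟩)
        lia
      rcases hcyc.eq_or_eq_of_isSpecial hspec hy with rfl | rfl <;> lia
    have hp := hone p (hcov p (by simp)) ((le_add_of_nonneg_right zero_le).trans hma)
    have hq := hone q (hcov q (by simp)) ((le_add_of_nonneg_left zero_le).trans hma)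
    -- Each consecutive pair has `a`-weight 2, so `p` and `q` get exactly 1 each. Summing around the
    -- cycle makes `s` twice the total of `p`, hence even.
    have hsum : ∑ i, (p (X i) + p (X (finRotate s i))) = ∑ _i : Fin s, 1 := by
      refine Finset.sum_congr rfl fun i _ => ?_
      have h1 := hle (X i)
      have h2 := hle (X (finRotate s i))
      rw [haX] at h1 h2
      have h3 := hp i
      have h4 := hq i
      lia
    rw [Finset.sum_add_distrib, Equiv.sum_comp (finRotate s) fun i => p (X i)] at hsum
    simp only [Finset.sum_const, Finset.card_univ, Fintype.card_fin, smul_eq_mul, mul_one] at hsum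
    obtain ⟨k, hk⟩ := hodd
    lia

/-- In the absence of special odd cycles all covers are decomposable. -/
theorem IsCover.isDecomposable_of_not_hasSpecialOddCycle [Finite V]
    (hΔ : ¬ HasSpecialOddCycle Δ) {k : ℕ} {a : vertices Δ →₀ ℕ} (ha : IsCover Δ k a) :
    IsDecomposable Δ k a := by
  classical
  let E : facets Δ → Finset (vertices Δ) := fun F => F.1.subtype fun x => x ∈ vertices Δ
  -- An odd cycle violating balance is literally a special odd cycle, after passing from `vertices
  -- Δ` to `V`.
  have hE : IsBalanced E := by
    intro s x e hodd hs hx he hmem hnext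
    by_contra! hcon
    refine hΔ ⟨s, fun i => x i, fun i => e i, hodd, ⟨hs, Subtype.val_injective.comp hx,
      Subtype.val_injective.comp he, fun i => (e i).2, fun i => Finset.mem_subtype.1 (hmem i),
      fun i => Finset.mem_subtype.1 (hnext i)⟩, fun i => ?_⟩
    refine (Set.ncard_le_ncard ?_ (Set.toFinite _)).trans
      ((Set.ncard_image_of_injective _ Subtype.val_injective).trans_le (hcon i))
    rintro _ ⟨hy, j, rfl⟩
    exact ⟨x j, ⟨Finset.mem_subtype.2 hy, j, rfl⟩, rfl⟩
  obtain ⟨m, hm, hma, hcov⟩ := hE.exists_decomposition (k := k) (a := a) fun F => by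
    convert ha F.1 F.2
  refine ⟨m, hm, hma, fun b hb F hF => ?_⟩
  convert hcov b hb ⟨F, hF⟩

theorem HasSpecialOddCycle.mono {Γ : PreAbstractSimplicialComplex V} (h : HasSpecialOddCycle Γ)
    (hΓ : facets Γ ⊆ facets Δ) : HasSpecialOddCycle Δ := by
  obtain ⟨s, x, F, hodd, hcyc, hspec⟩ := h
  exact ⟨s, x, F, hodd, { hcyc with facet_mem := fun i => hΓ (hcyc.facet_mem i) }, hspec⟩

end SpecialCycle

end QuasiTree

end

theorem theorem2p4 {V : Type*} [Finite V] (K : Type*) [Field K]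
    (Δ : PreAbstractSimplicialComplex V) (hΔ : QuasiTree.IsQuasiTree Δ) :
    [∀ Γ : PreAbstractSimplicialComplex V, QuasiTree.IsSMD Γ Δ →
        QuasiTree.VertexCoverAlgebraIsStandardGraded K Γ,
      QuasiTree.VertexCoverAlgebraIsStandardGraded K Δ,
      ¬ QuasiTree.HasSpecialOddCycle Δ].TFAE := by
  tfae_have 1 → 2 := fun h => h Δ ⟨le_rfl, subset_rfl⟩
  tfae_have 2 → 3 := by
    intro h hcyc
    obtain ⟨_, m, F, hF⟩ := hΔ
    obtain ⟨a, ha, hna⟩ := hF.isSeparating.not_isDecomposable hcyc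
    exact hna (QuasiTree.isDecomposable_of_isStandardGraded K h ha)
  tfae_have 3 → 1 := fun h Γ hΓ =>
    QuasiTree.isStandardGraded_of_isDecomposable K fun _ _ ha =>
      ha.isDecomposable_of_not_hasSpecialOddCycle fun hcyc => h (hcyc.mono hΓ.2)
  tfae_finish
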